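/- Fix two distinct datasets $D_1 \neq D_2$ of a set $\mathcal{D}$. The tradeoff curve of two probability distributions $P, Q$ on a common space is $T(P \,\|\, Q)(\alpha) = \inf_\phi \{\mathbb{E}_Q[1-\phi] : \mathbb{E}_P[\phi] \le \alpha\}$, $\alpha \in [0,1]$, where $\phi$ ranges over measurable $[0,1]$-valued (randomized) tests. A mechanism $M$ (a distribution $M(D)$ for each $D \in \mathcal{D}$) is $f$-DP if $T(M(D_1) \,\|\, M(D_2)) \ge f$ pointwise. For tradeoff curves $f_i = T(P_i \,\|\, Q_i)$ put $f_1 \otimes \dots \otimes f_n = T(P_1 \times \dots \times P_n \,\|\, Q_1 \times \dots \times Q_n)$. The $f$-DP natural filter with privacy bound $f$, family $\mathcal{G}$ of allowed tradeoff curves and query capacity $k$ interacts with an adaptive analyst for at most $k$ rounds. In round $i$ the analyst, depending on everything released so far, either stops or submits a mechanism $M_i$ together with a curve $f_i \in \mathcal{G}$ such that $M_i$ is $f_i$-DP; if $f_1 \otimes \dots \otimes f_i \ge f$, the filter releases $Y_i \sim M_i(D)$, and otherwise it releases nothing in that round. The filter is free if, for every such analyst, the mechanism that maps $D$ to the transcript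 of the whole interaction is $f$-DP. The family $\mathcal{G}$ admits free $f$-DP natural filters for $k$ queries if the filter is free for every tradeoff curve $f$. Let $\mathcal{T}$ be the family of all tradeoff curves and let $\mathcal{F} = \{f_{\varepsilon,\delta} : \varepsilon \ge 0,\ \delta \in [0,1]\}$, where $f_{\varepsilon,\delta}(\alpha) = \max\{0,\ 1-\delta-e^{\varepsilon}\alpha,\ e^{-\varepsilon}(1-\delta-\alpha)\}$. Corollary. For every query capacity $k \ge 2$, neither $\mathcal{T}$ nor $\mathcal{F}$ admits free $f$-DP natural filters: for each of these two families there are a tradeoff curve $f$ and an analyst whose interaction with the natural filter with bound $f$ and capacity $k$ is not $f$-DP. -/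

import Mathlib

open MeasureTheory ProbabilityTheory

namespace FDP

/-- Real curves on `[0, 1]`; `f ≤ g` is the pointwise order. -/
abbrev Curve : Type := unitInterval → ℝ

/-- The tradeoff curve `T(P ‖ Q)`: the least type II error among all (randomized) tests whose
type I error is at most `α`. Here `φ ω` is the probability of deciding `Q` at the outcome `ω`. -/
noncomputable def tradeoff {Ω : Type*} [MeasurableSpace Ω] (P Q : Measure Ω) : Curve := fun α =>
  sInf {β : ℝ | ∃ φ : Ω → ℝ, Measurable φ ∧ (∀ ω, 0 ≤ φ ω ∧ φ ω ≤ 1) ∧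
    ∫ ω, φ ω ∂P ≤ (α : ℝ) ∧ β = ∫ ω, (1 - φ ω) ∂Q}

/-- The family of all tradeoff curves. -/
def allTradeoffCurves : Set Curve :=
  {f | ∃ (Ω : Type) (_ : MeasurableSpace Ω) (P Q : Measure Ω),
    IsProbabilityMeasure P ∧ IsProbabilityMeasure Q ∧ tradeoff P Q = f}

/-- The tradeoff curve `f_{ε,δ}` of `(ε, δ)`-differential privacy. -/
noncomputable def epsDeltaCurve (ε δ : ℝ) : Curve := fun α =>
  max 0 (max (1 - δ - Real.exp ε * α) (Real.exp (-ε) * (1 - δ - α)))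

/-- The family of all `(ε, δ)`-DP tradeoff curves, `ε ≥ 0` and `δ ∈ [0, 1]`. -/
def epsDeltaCurves : Set Curve :=
  {f | ∃ ε δ : ℝ, 0 ≤ ε ∧ 0 ≤ δ ∧ δ ≤ 1 ∧ f = epsDeltaCurve ε δ}

/-- `IsComposition [f₁, …, fₙ] h` says that `h = f₁ ⊗ ⋯ ⊗ fₙ`: if `fᵢ = T(Pᵢ ‖ Qᵢ)`, then
`f₁ ⊗ ⋯ ⊗ fₙ = T(P₁ × ⋯ × Pₙ ‖ Q₁ × ⋯ × Qₙ)`. The curve `h` does not depend on the pairs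
`(Pᵢ, Qᵢ)` that represent the curves `fᵢ`. -/
def IsComposition (fs : List Curve) (h : Curve) : Prop :=
  ∃ (Ω : Fin fs.length → Type) (_ : ∀ i, MeasurableSpace (Ω i)) (P Q : ∀ i, Measure (Ω i)),
    (∀ i, IsProbabilityMeasure (P i)) ∧ (∀ i, IsProbabilityMeasure (Q i)) ∧
    (∀ i, tradeoff (P i) (Q i) = fs.get i) ∧
    tradeoff (Measure.pi P) (Measure.pi Q) = h

/-- Transcripts of the first `n` rounds: round `i` contributes either an answer `Sum.inl y` with
`y : Y i`, or `Sum.inr ()` when nothing is released in it. -/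
def Transcript (Y : ℕ → Type) : ℕ → Type
  | 0 => Unit
  | n + 1 => Transcript Y n × (Y n ⊕ Unit)

instance instMeasurableSpaceTranscript (Y : ℕ → Type)
    [∀ i, MeasurableSpace (Y i)] : ∀ n, MeasurableSpace (Transcript Y n)
  | 0 => (inferInstance : MeasurableSpace Unit)
  | n + 1 => @Prod.instMeasurableSpace (Transcript Y n) (Y n ⊕ Unit)
      (instMeasurableSpaceTranscript Y n) inferInstance

/-- An adaptive analyst. After seeing the transcript `h` of the rounds before round `i` (rounds are
numbered from `0`) the analyst stops (`curve i h = none`) or issues a query: the mechanism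
`D ↦ mech i D h` on datasets `D : 𝒟`, together with the curve `f` declared for it
(`curve i h = some f`). -/
structure Adversary (𝒟 : Type*) where
  /-- output space of the query in round `i` -/
  Y : ℕ → Type
  [measurableSpaceY : ∀ i, MeasurableSpace (Y i)]
  /-- the adaptive mechanism of round `i` -/
  mech : ∀ i, 𝒟 → Kernel (Transcript Y i) (Y i)
  [isMarkov : ∀ i D, IsMarkovKernel (mech i D)]
  /-- the tradeoff curve declared in round `i`, or `none` to stop -/
  curve : ∀ i, Transcript Y i → Option Curve

namespace Adversary

attribute [instance] Adversary.measurableSpaceY Adversary.isMarkov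

variable {𝒟 : Type*}

/-- Every declared curve lies in the family `F`, and every mechanism is `f`-DP, for its declared
curve `f`, with respect to the pair of datasets `(D₁, D₂)`. -/
def Respects (A : Adversary 𝒟) (D₁ D₂ : 𝒟) (F : Set Curve) : Prop :=
  ∀ i (h : Transcript A.Y i) (f : Curve), A.curve i h = some f →
    f ∈ F ∧ f ≤ tradeoff (A.mech i D₁ h) (A.mech i D₂ h)

/-- The list of the curves declared in the rounds `0, …, i`, if the analyst has not stopped in one
of these rounds, and `none` otherwise. -/
def declared (A : Adversary 𝒟) : ∀ i, Transcript A.Y i → Option (List Curve)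
  | 0, h => (A.curve 0 h).map fun f => [f]
  | i + 1, h => (A.declared i h.1).bind fun fs => (A.curve (i + 1) h).map fun f => fs ++ [f]

/-- The filter with privacy bound `B` answers in round `i`: the analyst has not stopped, and the
curves declared so far satisfy `f₀ ⊗ ⋯ ⊗ fᵢ ≥ B`. -/
def Accepted (A : Adversary 𝒟) (B : Curve) (i : ℕ) (h : Transcript A.Y i) : Prop :=
  ∃ fs, A.declared i h = some fs ∧ ∃ g, IsComposition fs g ∧ B ≤ g

/-- The filter's decisions are measurable functions of the transcript. -/
abbrev MeasurableDecisions (A : Adversary 𝒟) (B : Curve) : Prop :=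
  ∀ i, MeasurableSet {h : Transcript A.Y i | A.Accepted B i h}

open Classical in
/-- Round `i` of the interaction with the filter on the dataset `D`: the answer is drawn from the
mechanism of this round if the query is accepted, and nothing is released otherwise. -/
noncomputable def round (A : Adversary 𝒟) {B : Curve} (hA : A.MeasurableDecisions B) (D : 𝒟)
    (i : ℕ) : Kernel (Transcript A.Y i) (A.Y i ⊕ Unit) :=
  Kernel.piecewise (hA i) ((A.mech i D).map Sum.inl) (Kernel.const _ (Measure.dirac (Sum.inr ())))

instance instIsMarkovKernelRound (A : Adversary 𝒟) {B : Curve} (hA : A.MeasurableDecisions B)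
    (D : 𝒟) (i : ℕ) : IsMarkovKernel (A.round hA D i) := by
  have : IsMarkovKernel ((A.mech i D).map (Sum.inl : A.Y i → A.Y i ⊕ Unit)) :=
    Kernel.IsMarkovKernel.map _ measurable_inl
  unfold round
  infer_instance

/-- The law, on the dataset `D`, of the transcript of the first `k` rounds of the interaction of the
analyst with the filter with privacy bound `B`. -/
noncomputable def law (A : Adversary 𝒟) {B : Curve} (hA : A.MeasurableDecisions B) (D : 𝒟) :
    ∀ k, Measure (Transcript A.Y k)
  | 0 => (Measure.dirac () : Measure Unit)
  | k + 1 => (A.law hA D k).compProd (A.round hA D k)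

instance instIsProbabilityMeasureLaw (A : Adversary 𝒟) {B : Curve}
    (hA : A.MeasurableDecisions B) (D : 𝒟) : ∀ k, IsProbabilityMeasure (A.law hA D k)
  | 0 => inferInstanceAs (IsProbabilityMeasure (Measure.dirac () : Measure Unit))
  | k + 1 =>
    haveI := instIsProbabilityMeasureLaw A hA D k
    inferInstanceAs (IsProbabilityMeasure ((A.law hA D k).compProd (A.round hA D k)))

end Adversary

/-- The `f`-DP natural filter with privacy bound `B`, family `F` of allowed curves and query
capacity `k` is free: its interaction with any analyst that respects `F` is a `B`-DP mechanism. -/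
def FilterIsFree {𝒟 : Type*} (D₁ D₂ : 𝒟) (F : Set Curve) (B : Curve) (k : ℕ) : Prop :=
  ∀ A : Adversary 𝒟, A.Respects D₁ D₂ F → ∀ hA : A.MeasurableDecisions B,
    B ≤ tradeoff (A.law hA D₁ k) (A.law hA D₂ k)

/-- The family `F` admits free `f`-DP natural filters for `k` queries: the natural filter is free
for every privacy bound `B`, where `B` is a tradeoff curve. -/
def AdmitsFreeFilters {𝒟 : Type*} (D₁ D₂ : 𝒟) (F : Set Curve) (k : ℕ) : Prop :=
  ∀ B ∈ allTradeoffCurves, FilterIsFree D₁ D₂ F B k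

end FDP

namespace FDP

/-! ### Tests and tradeoff curves -/

section Tradeoff

variable {Ω Ω' : Type*} [MeasurableSpace Ω] [MeasurableSpace Ω']

/-! Two fixed query sequences can each exhaust the same bound while an adaptive choice between them
exceeds it. Take the bound `epsDeltaCurve (Real.log 2) (2 / 9)`. Up to level `2 / 9` it allows the
divergence `∑ max 0 (q - 2 * p)`, where `p`, `q` are the point masses on `D₁`, `D₂`.

Round `0` is randomized response with likelihood ratios `2` and `1 / 2`. For round `1` there are two
options: randomized response again, or a mechanism with `ε = 0`, `δ = 2 / 9`. Either one, composed
with round `0`, has divergence exactly `2 / 9`, so the filter accepts both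
(`exists_isComposition_answerCurve_pair`). The divergence arises in different branches, though.
After `true` the effective factor drops from `2` to `1`, and the options contribute `2 / 9` and `4 /
27`; after `false` it rises to `4`, and they contribute `0` and `2 / 27`. Choosing the better option
in each branch yields `8 / 27 > 2 / 9`.

Acceptance reduces to finite sums because `tradeoff_canon` represents each `epsDeltaCurve` by a
four-point pair. The violation is witnessed by the event that the second answer is `true`
(`separatingAdversary_law_two`). -/

theorem tradeoff_le_of_test {P Q : Measure Ω} {α : unitInterval} {φ : Ω → ℝ} (hφ : Measurable φ)
    (h01 : ∀ ω, 0 ≤ φ ω ∧ φ ω ≤ 1) (hα : ∫ ω, φ ω ∂P ≤ α) :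
    tradeoff P Q α ≤ ∫ ω, (1 - φ ω) ∂Q := by
  refine csInf_le ⟨0, ?_⟩ ⟨φ, hφ, h01, hα, rfl⟩
  rintro _ ⟨ψ, -, hψ, -, rfl⟩
  exact integral_nonneg fun ω => sub_nonneg.2 (hψ ω).2

theorem le_tradeoff {P Q : Measure Ω} {α : unitInterval} {b : ℝ}
    (h : ∀ φ : Ω → ℝ, Measurable φ → (∀ ω, 0 ≤ φ ω ∧ φ ω ≤ 1) → ∫ ω, φ ω ∂P ≤ α →
      b ≤ ∫ ω, (1 - φ ω) ∂Q) :
    b ≤ tradeoff P Q α := by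
  -- The zero test is always admissible; nonemptiness matters because `sInf ∅ = 0` in `ℝ`.
  refine le_csInf ⟨_, fun _ => 0, measurable_const, by simp, by simpa using α.2.1, rfl⟩ ?_
  rintro _ ⟨φ, hφ, h01, hα, rfl⟩
  exact h φ hφ h01 hα

/-- Post-processing does not decrease the tradeoff curve. -/
theorem tradeoff_le_of_measurePreserving {P Q : Measure Ω} {P' Q' : Measure Ω'} {f : Ω → Ω'}
    (hP : MeasurePreserving f P P') (hQ : MeasurePreserving f Q Q') :
    tradeoff P Q ≤ tradeoff P' Q' := by
  intro α
  refine le_tradeoff fun φ hφ h01 hα => ?_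
  rw [← hP.map_eq, integral_map hP.aemeasurable hφ.aestronglyMeasurable] at hα
  rw [← hQ.map_eq, integral_map hQ.aemeasurable (by fun_prop)]
  exact tradeoff_le_of_test (hφ.comp hP.measurable) (fun ω => h01 _) hα

theorem integrable_of_mem_Icc {P : Measure Ω} [IsFiniteMeasure P] {φ : Ω → ℝ} (hφ : Measurable φ)
    (h01 : ∀ ω, 0 ≤ φ ω ∧ φ ω ≤ 1) : Integrable φ P :=
  Integrable.of_bound hφ.aestronglyMeasurable 1 (ae_of_all _ fun ω => by
    rw [Real.norm_eq_abs, abs_of_nonneg (h01 ω).1]; exact (h01 ω).2)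

theorem integral_one_sub {P : Measure Ω} [IsProbabilityMeasure P] {φ : Ω → ℝ}
    (hφ : Measurable φ) (h01 : ∀ ω, 0 ≤ φ ω ∧ φ ω ≤ 1) :
    ∫ ω, (1 - φ ω) ∂P = 1 - ∫ ω, φ ω ∂P := by
  rw [integral_sub (integrable_const _) (integrable_of_mem_Icc hφ h01)]
  simp

theorem tradeoff_le_one_sub {P Q : Measure Ω} [IsProbabilityMeasure Q] {α : unitInterval}
    {S : Set Ω} (hS : MeasurableSet S) (hα : P.real S ≤ α) : tradeoff P Q α ≤ 1 - Q.real S := by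
  have hφ : Measurable (S.indicator (1 : Ω → ℝ)) := measurable_one.indicator hS
  have h01 : ∀ ω, 0 ≤ S.indicator (1 : Ω → ℝ) ω ∧ S.indicator (1 : Ω → ℝ) ω ≤ 1 := fun ω =>
    ⟨Set.indicator_nonneg (fun _ _ => zero_le_one) ω,
      Set.indicator_le_self' (fun _ _ => zero_le_one) ω⟩
  have h := tradeoff_le_of_test (Q := Q) hφ h01 (by rwa [integral_indicator_one hS])
  rwa [integral_one_sub hφ h01, integral_indicator_one hS] at h

/-- Approximate differential privacy in both directions bounds the tradeoff curve from below. -/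
theorem epsDeltaCurve_le_tradeoff {P Q : Measure Ω} [IsProbabilityMeasure P]
    [IsProbabilityMeasure Q] {ε δ : ℝ}
    (hQP : ∀ φ : Ω → ℝ, Measurable φ → (∀ ω, 0 ≤ φ ω ∧ φ ω ≤ 1) →
      ∫ ω, φ ω ∂Q ≤ Real.exp ε * ∫ ω, φ ω ∂P + δ)
    (hPQ : ∀ φ : Ω → ℝ, Measurable φ → (∀ ω, 0 ≤ φ ω ∧ φ ω ≤ 1) →
      ∫ ω, φ ω ∂P ≤ Real.exp ε * ∫ ω, φ ω ∂Q + δ) :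
    epsDeltaCurve ε δ ≤ tradeoff P Q := by
  intro α
  refine le_tradeoff fun φ hφ h01 hα => ?_
  have h01' : ∀ ω, 0 ≤ 1 - φ ω ∧ 1 - φ ω ≤ 1 := fun ω =>
    ⟨sub_nonneg.2 (h01 ω).2, by linarith [(h01 ω).1]⟩
  have hε := Real.exp_pos ε
  refine max_le (integral_nonneg fun ω => (h01' ω).1) (max_le ?_ ?_)
  · rw [integral_one_sub hφ h01]
    nlinarith [hQP φ hφ h01]
  -- The complementary test, with the two measures exchanged, gives the branch with slope `-exp
  -- (-ε)`.
  · have h := hPQ (fun ω => 1 - φ ω) (by fun_prop) h01'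
    rw [integral_one_sub (P := P) hφ h01] at h
    rw [Real.exp_neg, inv_mul_le_iff₀ hε]
    linarith

end Tradeoff

/-! ### Finitely supported measures and hockey-stick divergence -/

section Weighted

variable {Ω Ω' : Type*} [Fintype Ω] [MeasurableSpace Ω] [Fintype Ω'] [MeasurableSpace Ω']

/-- The measure on a finite type with the given point masses. -/
noncomputable def weighted (p : Ω → ℝ) : Measure Ω :=
  ∑ i, ENNReal.ofReal (p i) • Measure.dirac i

theorem isProbabilityMeasure_weighted {p : Ω → ℝ} (h0 : ∀ i, 0 ≤ p i) (h1 : ∑ i, p i = 1) :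
    IsProbabilityMeasure (weighted p) := by
  constructor
  simp [weighted, ← ENNReal.ofReal_sum_of_nonneg fun i _ => h0 i, h1]

variable [MeasurableSingletonClass Ω] [MeasurableSingletonClass Ω']

theorem integral_weighted {p : Ω → ℝ} (h0 : ∀ i, 0 ≤ p i) (φ : Ω → ℝ) :
    ∫ ω, φ ω ∂(weighted p) = ∑ i, p i * φ i := by
  rw [weighted, integral_finsetSum_measure fun i _ =>
    (integrable_dirac (by simp)).smul_measure ENNReal.ofReal_ne_top]
  simp [integral_smul_measure, ENNReal.toReal_ofReal, h0]

theorem weighted_singleton (p : Ω → ℝ) (a : Ω) : weighted p {a} = ENNReal.ofReal (p a) := by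
  classical
  simp [weighted, Set.indicator_apply]

theorem weighted_prod {p : Ω → ℝ} (hp : ∀ i, 0 ≤ p i) (q : Ω' → ℝ) :
    (weighted p).prod (weighted q) = weighted fun x : Ω × Ω' => p x.1 * q x.2 := by
  have : SFinite (weighted q) := by unfold weighted; infer_instance
  refine Measure.ext_of_singleton fun x => ?_
  rw [weighted_singleton, ← Prod.mk.eta (p := x), ← Set.singleton_prod_singleton,
    Measure.prod_prod, weighted_singleton, weighted_singleton, ENNReal.ofReal_mul (hp _)]

/-- The difference of the two integrals is `∑ (q i - γ * p i) * φ i`, which is largest when `φ`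
indicates `q > γ * p`. -/
theorem integral_weighted_le {p q : Ω → ℝ} (hp : ∀ i, 0 ≤ p i) (hq : ∀ i, 0 ≤ q i) {γ δ : ℝ}
    (h : ∑ i, max 0 (q i - γ * p i) ≤ δ) {φ : Ω → ℝ} (h01 : ∀ ω, 0 ≤ φ ω ∧ φ ω ≤ 1) :
    ∫ ω, φ ω ∂(weighted q) ≤ γ * ∫ ω, φ ω ∂(weighted p) + δ := by
  rw [integral_weighted hp, integral_weighted hq, ← sub_le_iff_le_add', Finset.mul_sum,
    ← Finset.sum_sub_distrib]
  refine (Finset.sum_le_sum fun i _ => ?_).trans h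
  calc q i * φ i - γ * (p i * φ i) = (q i - γ * p i) * φ i := by ring
    _ ≤ max 0 (q i - γ * p i) * φ i := mul_le_mul_of_nonneg_right (le_max_right _ _) (h01 i).1
    _ ≤ max 0 (q i - γ * p i) := mul_le_of_le_one_right (le_max_left _ _) (h01 i).2

theorem epsDeltaCurve_le_tradeoff_weighted {p q : Ω → ℝ} (hp : ∀ i, 0 ≤ p i) (hq : ∀ i, 0 ≤ q i)
    (hp1 : ∑ i, p i = 1) (hq1 : ∑ i, q i = 1) {ε δ : ℝ}
    (hqp : ∑ i, max 0 (q i - Real.exp ε * p i) ≤ δ)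
    (hpq : ∑ i, max 0 (p i - Real.exp ε * q i) ≤ δ) :
    epsDeltaCurve ε δ ≤ tradeoff (weighted p) (weighted q) := by
  have := isProbabilityMeasure_weighted hp hp1
  have := isProbabilityMeasure_weighted hq hq1
  exact epsDeltaCurve_le_tradeoff (fun φ _ h01 => integral_weighted_le hp hq hqp h01)
    (fun φ _ h01 => integral_weighted_le hq hp hpq h01)

end Weighted

/-! ### The canonical pair representing an `(ε, δ)`-curve -/

section Canonical

/-- Point masses of the canonical `(ε, δ)`-DP mechanism on the first dataset. -/
noncomputable def canonP (ε δ : ℝ) : Fin 4 → ℝ :=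
  ![δ, Real.exp ε * ((1 - δ) / (1 + Real.exp ε)), (1 - δ) / (1 + Real.exp ε), 0]

/-- Point masses of the canonical `(ε, δ)`-DP mechanism on the second dataset. -/
noncomputable def canonQ (ε δ : ℝ) : Fin 4 → ℝ :=
  ![0, (1 - δ) / (1 + Real.exp ε), Real.exp ε * ((1 - δ) / (1 + Real.exp ε)), δ]

variable {ε δ : ℝ}

theorem canonP_nonneg (h0 : 0 ≤ δ) (h1 : δ ≤ 1) (i : Fin 4) : 0 ≤ canonP ε δ i := by
  have : 0 ≤ 1 - δ := sub_nonneg.2 h1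
  fin_cases i <;> simp [canonP] <;> positivity

theorem canonQ_nonneg (h0 : 0 ≤ δ) (h1 : δ ≤ 1) (i : Fin 4) : 0 ≤ canonQ ε δ i := by
  have : 0 ≤ 1 - δ := sub_nonneg.2 h1
  fin_cases i <;> simp [canonQ] <;> positivity

theorem sum_canonP (ε δ : ℝ) : ∑ i, canonP ε δ i = 1 := by
  have := Real.exp_pos ε
  simp only [Fin.sum_univ_four, canonP, Matrix.cons_val]
  field_simp
  ring

theorem sum_canonQ (ε δ : ℝ) : ∑ i, canonQ ε δ i = 1 := by
  have := Real.exp_pos ε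
  simp only [Fin.sum_univ_four, canonQ, Matrix.cons_val]
  field_simp
  ring

theorem exists_mul_eq_of_le {a b : ℝ} (ha : 0 ≤ a) (hab : a ≤ b) :
    ∃ v, 0 ≤ v ∧ v ≤ 1 ∧ b * v = a := by
  rcases (ha.trans hab).eq_or_lt with rfl | hb
  · exact ⟨0, le_rfl, zero_le_one, by linarith⟩
  · exact ⟨a / b, div_nonneg ha hb.le, div_le_one_of_le₀ hab hb.le, mul_div_cancel₀ a hb.ne'⟩

/-- The upper bound uses Neyman–Pearson tests; the lower bound holds because both hockey-stick sums
equal `δ`, carried by the outcome that is impossible under the other measure. -/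
theorem tradeoff_canon (hε : 0 ≤ ε) (h0 : 0 ≤ δ) (h1 : δ ≤ 1) :
    tradeoff (weighted (canonP ε δ)) (weighted (canonQ ε δ)) = epsDeltaCurve ε δ := by
  have hP := canonP_nonneg (ε := ε) h0 h1
  have hQ := canonQ_nonneg (ε := ε) h0 h1
  have he : 1 ≤ Real.exp ε := Real.one_le_exp hε
  refine le_antisymm (fun α => ?_) ?_
  -- Outcome `3` costs no type I error and outcome `0` gains no power. The budget goes to outcome
  -- `2` (weight `v`), then to outcome `1` (weight `u`), in order of likelihood ratio.
  · have key : ∀ u v : ℝ, 0 ≤ u → u ≤ 1 → 0 ≤ v → v ≤ 1 →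
        Real.exp ε * ((1 - δ) / (1 + Real.exp ε)) * u + (1 - δ) / (1 + Real.exp ε) * v ≤ α →
        tradeoff (weighted (canonP ε δ)) (weighted (canonQ ε δ)) α ≤
          (1 - δ) / (1 + Real.exp ε) * (1 - u) +
            Real.exp ε * ((1 - δ) / (1 + Real.exp ε)) * (1 - v) := by
      intro u v hu0 hu1 hv0 hv1 h
      refine (tradeoff_le_of_test (φ := ![0, u, v, 1]) (measurable_of_finite _) ?_ ?_).trans_eq ?_
      · intro i; fin_cases i <;> simp [*]
      · rw [integral_weighted hP]
        simpa [Fin.sum_univ_four, canonP] using h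
      · rw [integral_weighted hQ]
        simp [Fin.sum_univ_four, canonQ]
    have hs : Real.exp ε * ((1 - δ) / (1 + Real.exp ε)) + (1 - δ) / (1 + Real.exp ε) = 1 - δ := by
      field_simp
      ring
    have ht0 : 0 ≤ (1 - δ) / (1 + Real.exp ε) := div_nonneg (sub_nonneg.2 h1) (by positivity)
    change _ ≤ max 0 (max (1 - δ - Real.exp ε * α) (Real.exp (-ε) * (1 - δ - α)))
    rw [Real.exp_neg]
    generalize (1 - δ) / (1 + Real.exp ε) = t at key hs ht0
    have hx : 0 < Real.exp ε := Real.exp_pos ε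
    generalize Real.exp ε = x at key hs hx
    -- The curve has its kinks at `t`, where outcome `2` is used up, and at `1 - δ`, where the type
    -- II error reaches `0`.
    rcases le_total (α : ℝ) t with hαt | hαt
    · obtain ⟨v, hv0, hv1, hv⟩ := exists_mul_eq_of_le α.2.1 hαt
      refine le_max_of_le_right (le_max_of_le_left ?_)
      refine (key 0 v le_rfl zero_le_one hv0 hv1 (by linarith)).trans_eq ?_
      rw [← hs, ← hv]
      ring
    rcases le_total (α : ℝ) (1 - δ) with hα | hα
    · obtain ⟨u, hu0, hu1, hu⟩ : ∃ u, 0 ≤ u ∧ u ≤ 1 ∧ x * t * u = α - t :=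
        exists_mul_eq_of_le (by linarith) (by linarith)
      refine le_max_of_le_right (le_max_of_le_right ?_)
      refine (key u 1 hu0 hu1 zero_le_one le_rfl (by linarith)).trans_eq ?_
      rw [eq_inv_mul_iff_mul_eq₀ hx.ne', ← hs]
      linarith
    · refine le_max_of_le_left ((key 1 1 zero_le_one le_rfl zero_le_one le_rfl ?_).trans_eq ?_)
      · linarith
      · ring
  · refine epsDeltaCurve_le_tradeoff_weighted hP hQ (sum_canonP _ _) (sum_canonQ _ _) ?_ ?_
    all_goals
      have ht0 : 0 ≤ (1 - δ) / (1 + Real.exp ε) := div_nonneg (sub_nonneg.2 h1) (by positivity)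
      simp only [Fin.sum_univ_four, canonP, canonQ, Matrix.cons_val]
      generalize (1 - δ) / (1 + Real.exp ε) = t at ht0
      generalize Real.exp ε = x at he
      have h2 : t - x * (x * t) ≤ 0 := by nlinarith [mul_nonneg ht0 (sub_nonneg.2 he)]
      have h3 : 0 ≤ x * δ := by nlinarith
      simp [max_eq_left h2, h0, h3]

theorem epsDeltaCurves_subset_allTradeoffCurves : epsDeltaCurves ⊆ allTradeoffCurves := by
  rintro _ ⟨ε, δ, hε, h0, h1, rfl⟩
  exact ⟨Fin 4, inferInstance, _, _,
    isProbabilityMeasure_weighted (canonP_nonneg h0 h1) (sum_canonP _ _),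
    isProbabilityMeasure_weighted (canonQ_nonneg h0 h1) (sum_canonQ _ _), tradeoff_canon hε h0 h1⟩

end Canonical

/-! ### Lower bounds for compositions -/

section Composition

/-- Acceptance needs only a lower bound on the composed curve, so one measure-preserving map into
the `Fin`-indexed product suffices. -/
theorem isComposition_singleton {Ω : Type} [MeasurableSpace Ω] {P Q : Measure Ω}
    [hP : IsProbabilityMeasure P] [hQ : IsProbabilityMeasure Q] :
    ∃ g, IsComposition [tradeoff P Q] g ∧ tradeoff P Q ≤ g := by
  refine ⟨_, ⟨fun _ => Ω, fun _ => inferInstance, fun _ => P, fun _ => Q, fun _ => hP, fun _ => hQ,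
    Fin.forall_fin_one.2 rfl, rfl⟩, ?_⟩
  exact tradeoff_le_of_measurePreserving
    (measurePreserving_piUnique (ι := Fin 1) fun _ => P).symm
    (measurePreserving_piUnique (ι := Fin 1) fun _ => Q).symm

theorem isComposition_pair {Ω : Type} [MeasurableSpace Ω] {P Q P' Q' : Measure Ω}
    [hP : IsProbabilityMeasure P] [hQ : IsProbabilityMeasure Q]
    [hP' : IsProbabilityMeasure P'] [hQ' : IsProbabilityMeasure Q'] :
    ∃ g, IsComposition [tradeoff P Q, tradeoff P' Q'] g ∧
      tradeoff (P.prod P') (Q.prod Q') ≤ g := by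
  have h1 : ∀ i : Fin 2, IsProbabilityMeasure ((![P, P'] : Fin 2 → Measure Ω) i) :=
    Fin.forall_fin_two.2 ⟨hP, hP'⟩
  have h2 : ∀ i : Fin 2, IsProbabilityMeasure ((![Q, Q'] : Fin 2 → Measure Ω) i) :=
    Fin.forall_fin_two.2 ⟨hQ, hQ'⟩
  refine ⟨_, ⟨fun _ => Ω, fun _ => inferInstance, ![P, P'], ![Q, Q'], h1, h2,
    Fin.forall_fin_two.2 ⟨rfl, rfl⟩, rfl⟩, ?_⟩
  exact tradeoff_le_of_measurePreserving (measurePreserving_piFinTwo ![P, P']).symm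
    (measurePreserving_piFinTwo ![Q, Q']).symm

theorem exists_isComposition_singleton {ε δ ε' δ' : ℝ} (hε : 0 ≤ ε) (h0 : 0 ≤ δ) (h1 : δ ≤ 1)
    (h : epsDeltaCurve ε' δ' ≤ epsDeltaCurve ε δ) :
    ∃ g, IsComposition [epsDeltaCurve ε δ] g ∧ epsDeltaCurve ε' δ' ≤ g := by
  have := isProbabilityMeasure_weighted (canonP_nonneg (ε := ε) h0 h1) (sum_canonP _ _)
  have := isProbabilityMeasure_weighted (canonQ_nonneg (ε := ε) h0 h1) (sum_canonQ _ _)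
  rw [← tradeoff_canon hε h0 h1] at h ⊢
  obtain ⟨g, hg, hle⟩ := isComposition_singleton
    (P := weighted (canonP ε δ)) (Q := weighted (canonQ ε δ))
  exact ⟨g, hg, h.trans hle⟩

/-- The composition of two `(ε, δ)`-curves is bounded below as soon as the hockey-stick divergences
of the product of the canonical mechanisms are small. -/
theorem exists_isComposition_pair {ε₁ δ₁ ε₂ δ₂ ε δ : ℝ} (hε₁ : 0 ≤ ε₁) (h0₁ : 0 ≤ δ₁)
    (h1₁ : δ₁ ≤ 1) (hε₂ : 0 ≤ ε₂) (h0₂ : 0 ≤ δ₂) (h1₂ : δ₂ ≤ 1)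
    (hqp : ∑ i, ∑ j, max 0 (canonQ ε₁ δ₁ i * canonQ ε₂ δ₂ j -
      Real.exp ε * (canonP ε₁ δ₁ i * canonP ε₂ δ₂ j)) ≤ δ)
    (hpq : ∑ i, ∑ j, max 0 (canonP ε₁ δ₁ i * canonP ε₂ δ₂ j -
      Real.exp ε * (canonQ ε₁ δ₁ i * canonQ ε₂ δ₂ j)) ≤ δ) :
    ∃ g, IsComposition [epsDeltaCurve ε₁ δ₁, epsDeltaCurve ε₂ δ₂] g ∧ epsDeltaCurve ε δ ≤ g := by
  have hP₁ := canonP_nonneg (ε := ε₁) h0₁ h1₁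
  have hQ₁ := canonQ_nonneg (ε := ε₁) h0₁ h1₁
  have hP₂ := canonP_nonneg (ε := ε₂) h0₂ h1₂
  have hQ₂ := canonQ_nonneg (ε := ε₂) h0₂ h1₂
  have := isProbabilityMeasure_weighted hP₁ (sum_canonP _ _)
  have := isProbabilityMeasure_weighted hQ₁ (sum_canonQ _ _)
  have := isProbabilityMeasure_weighted hP₂ (sum_canonP _ _)
  have := isProbabilityMeasure_weighted hQ₂ (sum_canonQ _ _)
  rw [← tradeoff_canon hε₁ h0₁ h1₁, ← tradeoff_canon hε₂ h0₂ h1₂]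
  obtain ⟨g, hg, hle⟩ := isComposition_pair
    (P := weighted (canonP ε₁ δ₁)) (Q := weighted (canonQ ε₁ δ₁))
    (P' := weighted (canonP ε₂ δ₂)) (Q' := weighted (canonQ ε₂ δ₂))
  refine ⟨g, hg, le_trans ?_ hle⟩
  rw [weighted_prod hP₁, weighted_prod hQ₁]
  refine epsDeltaCurve_le_tradeoff_weighted (fun x => mul_nonneg (hP₁ _) (hP₂ _))
    (fun x => mul_nonneg (hQ₁ _) (hQ₂ _)) ?_ ?_ ?_ ?_
  · rw [Fintype.sum_prod_type, ← Fintype.sum_mul_sum, sum_canonP, sum_canonP, one_mul]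
  · rw [Fintype.sum_prod_type, ← Fintype.sum_mul_sum, sum_canonQ, sum_canonQ, one_mul]
  · rwa [Fintype.sum_prod_type]
  · rwa [Fintype.sum_prod_type]

end Composition

/-! ### The law of the transcript -/

section Interaction

instance instCountableTranscript (Y : ℕ → Type) [∀ i, Countable (Y i)] :
    ∀ n, Countable (Transcript Y n)
  | 0 => inferInstanceAs (Countable Unit)
  | n + 1 =>
    haveI := instCountableTranscript Y n
    inferInstanceAs (Countable (Transcript Y n × (Y n ⊕ Unit)))

theorem measurableSingletonClass_sum {α β : Type*} [MeasurableSpace α] [MeasurableSpace β]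
    [MeasurableSingletonClass α] [MeasurableSingletonClass β] :
    MeasurableSingletonClass (α ⊕ β) := by
  constructor
  rintro (a | b)
  · rw [← Set.image_singleton]
    exact MeasurableSet.inl_image (measurableSet_singleton a)
  · rw [← Set.image_singleton]
    exact MeasurableSet.inr_image (measurableSet_singleton b)

instance instMeasurableSingletonClassTranscript (Y : ℕ → Type) [∀ i, MeasurableSpace (Y i)]
    [∀ i, MeasurableSingletonClass (Y i)] : ∀ n, MeasurableSingletonClass (Transcript Y n)
  | 0 => inferInstanceAs (MeasurableSingletonClass Unit)
  | n + 1 =>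
    haveI := instMeasurableSingletonClassTranscript Y n
    haveI := measurableSingletonClass_sum (α := Y n) (β := Unit)
    inferInstanceAs (MeasurableSingletonClass (Transcript Y n × (Y n ⊕ Unit)))

namespace Adversary

variable {𝒟 : Type*} (A : Adversary 𝒟) {B : Curve}

theorem measurePreserving_fst_law (hA : A.MeasurableDecisions B) (D : 𝒟) (k : ℕ) :
    MeasurePreserving (Prod.fst : Transcript A.Y (k + 1) → Transcript A.Y k)
      (A.law hA D (k + 1)) (A.law hA D k) :=
  ⟨measurable_fst, Measure.fst_compProd (A.law hA D k) (A.round hA D k)⟩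

/-- The transcript of fewer rounds is a post-processing of the transcript of more rounds. -/
theorem antitone_tradeoff_law (hA : A.MeasurableDecisions B) (D₁ D₂ : 𝒟) :
    Antitone fun k => tradeoff (A.law hA D₁ k) (A.law hA D₂ k) :=
  antitone_nat_of_succ_le fun k => tradeoff_le_of_measurePreserving
    (A.measurePreserving_fst_law hA D₁ k) (A.measurePreserving_fst_law hA D₂ k)

theorem round_of_accepted (hA : A.MeasurableDecisions B) (D : 𝒟) {i : ℕ} {h : Transcript A.Y i}
    (hacc : A.Accepted B i h) : A.round hA D i h = (A.mech i D h).map Sum.inl := by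
  classical
  rw [round, Kernel.piecewise_apply, if_pos (show h ∈ {h | A.Accepted B i h} from hacc),
    Kernel.map_apply _ measurable_inl]

/-- The probability that the answer in round `1` is `y`, if the filter answers in rounds `0`
and `1`. -/
theorem law_two_inl (hA : A.MeasurableDecisions B) (D : 𝒟)
    (h0 : A.Accepted B 0 ()) (h1 : ∀ y : A.Y 0, A.Accepted B 1 ((), Sum.inl y))
    {s : Set (A.Y 1)} (hs : MeasurableSet s) :
    A.law hA D 2 {h : Transcript A.Y 2 | h.2 ∈ Sum.inl '' s} =
      ∫⁻ y, A.mech 1 D ((), Sum.inl y) s ∂(A.mech 0 D ()) := by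
  have hs' : MeasurableSet (Sum.inl '' s : Set (A.Y 1 ⊕ Unit)) := hs.inl_image
  have e2 : A.law hA D 2 {h : Transcript A.Y 2 | h.2 ∈ Sum.inl '' s} =
      ∫⁻ h, A.round hA D 1 h (Sum.inl '' s) ∂(A.law hA D 1) :=
    Measure.compProd_apply (measurable_snd hs')
  have hm : Measurable fun h => A.round hA D 1 h (Sum.inl '' s) := Kernel.measurable_coe _ hs'
  have e1 : ∫⁻ h, A.round hA D 1 h (Sum.inl '' s) ∂(A.law hA D 1) =
      ∫⁻ y, A.round hA D 1 ((), y) (Sum.inl '' s) ∂(A.round hA D 0 ()) := by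
    refine (Measure.lintegral_compProd (μ := A.law hA D 0) (κ := A.round hA D 0) hm).trans ?_
    exact lintegral_dirac () _
  rw [e2, e1, A.round_of_accepted hA D h0]
  refine (lintegral_map (μ := A.mech 0 D ())
    (hm.comp (measurable_prodMk_left (x := ()))) measurable_inl).trans ?_
  refine lintegral_congr fun y => ?_
  change A.round hA D 1 ((), Sum.inl y) (Sum.inl '' s) = _
  rw [A.round_of_accepted hA D (h1 y), Measure.map_apply measurable_inl hs',
    Set.preimage_image_eq _ Sum.inl_injective]

end Adversary

end Interaction

/-! ### Binary answers -/

section Bernoulli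

theorem lintegral_weighted {Ω : Type*} [Fintype Ω] [MeasurableSpace Ω]
    [MeasurableSingletonClass Ω] (p : Ω → ℝ) (F : Ω → ENNReal) :
    ∫⁻ ω, F ω ∂(weighted p) = ∑ i, ENNReal.ofReal (p i) * F i := by
  simp [weighted]

/-- The law of a binary answer that is `true` with probability `p`. -/
noncomputable def bernoulli (p : ℝ) : Measure Bool := weighted fun b => bif b then p else 1 - p

theorem isProbabilityMeasure_bernoulli {p : ℝ} (h0 : 0 ≤ p) (h1 : p ≤ 1) :
    IsProbabilityMeasure (bernoulli p) :=
  isProbabilityMeasure_weighted (by simp [h0, h1]) (by simp)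

theorem bernoulli_true (p : ℝ) : bernoulli p {true} = ENNReal.ofReal p :=
  weighted_singleton _ _

theorem epsDeltaCurve_le_tradeoff_bernoulli {p q ε δ : ℝ} (hp0 : 0 ≤ p) (hp1 : p ≤ 1)
    (hq0 : 0 ≤ q) (hq1 : q ≤ 1)
    (hqp : max 0 (q - Real.exp ε * p) + max 0 (1 - q - Real.exp ε * (1 - p)) ≤ δ)
    (hpq : max 0 (p - Real.exp ε * q) + max 0 (1 - p - Real.exp ε * (1 - q)) ≤ δ) :
    epsDeltaCurve ε δ ≤ tradeoff (bernoulli p) (bernoulli q) :=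
  epsDeltaCurve_le_tradeoff_weighted (by simp [hp0, hp1]) (by simp [hq0, hq1]) (by simp)
    (by simp) (by simpa using hqp) (by simpa using hpq)

end Bernoulli

/-! ### The adaptive analyst that defeats the filter -/

section Counterexample

/-- Whether the query in a given round is randomized response: it is, except after the answer
`false` in round `0`. -/
def asksResponse : ∀ i, Transcript (fun _ => Bool) i → Bool
  | 1, h => Sum.elim id (fun _ => true) h.2
  | _, _ => true

/-- The probability of the answer `true`, on the first dataset if `first`, otherwise on the other
ones: of randomized response if `rr`, otherwise of a mechanism that answers `true` with probability
`2 / 9`, and never on the first dataset. -/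
noncomputable def answerProb (first rr : Bool) : ℝ :=
  bif rr then (bif first then 1 / 3 else 2 / 3) else (bif first then 0 else 2 / 9)

theorem answerProb_nonneg (first rr : Bool) : 0 ≤ answerProb first rr := by
  cases first <;> cases rr <;> norm_num [answerProb]

theorem answerProb_le_one (first rr : Bool) : answerProb first rr ≤ 1 := by
  cases first <;> cases rr <;> norm_num [answerProb]

/-- The curve declared for randomized response if `rr`, and for the other mechanism otherwise. -/
noncomputable def answerCurve (rr : Bool) : Curve :=
  bif rr then epsDeltaCurve (Real.log 2) 0 else epsDeltaCurve 0 (2 / 9)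

theorem exp_log_two : Real.exp (Real.log 2) = 2 := Real.exp_log two_pos

theorem log_two_nonneg : 0 ≤ Real.log 2 := Real.log_nonneg one_le_two

theorem answerCurve_mem (rr : Bool) : answerCurve rr ∈ epsDeltaCurves := by
  cases rr
  · exact ⟨0, 2 / 9, le_rfl, by norm_num, by norm_num, rfl⟩
  · exact ⟨Real.log 2, 0, log_two_nonneg, le_rfl, zero_le_one, rfl⟩

theorem answerCurve_le_tradeoff (rr : Bool) :
    answerCurve rr ≤
      tradeoff (bernoulli (answerProb true rr)) (bernoulli (answerProb false rr)) := by
  cases rr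
  · refine epsDeltaCurve_le_tradeoff_bernoulli (answerProb_nonneg _ _) (answerProb_le_one _ _)
      (answerProb_nonneg _ _) (answerProb_le_one _ _) ?_ ?_ <;> norm_num [answerProb]
  · refine epsDeltaCurve_le_tradeoff_bernoulli (answerProb_nonneg _ _) (answerProb_le_one _ _)
      (answerProb_nonneg _ _) (answerProb_le_one _ _) ?_ ?_ <;>
      norm_num [answerProb, exp_log_two]

/-- The privacy bound for which the natural filter is not free. -/
noncomputable def privacyBound : Curve := epsDeltaCurve (Real.log 2) (2 / 9)

theorem privacyBound_mem : privacyBound ∈ allTradeoffCurves :=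
  epsDeltaCurves_subset_allTradeoffCurves
    ⟨Real.log 2, 2 / 9, log_two_nonneg, by norm_num, by norm_num, rfl⟩

theorem exists_isComposition_answerCurve :
    ∃ g, IsComposition [answerCurve true] g ∧ privacyBound ≤ g := by
  refine exists_isComposition_singleton log_two_nonneg le_rfl zero_le_one fun α => ?_
  have := Real.exp_pos (-Real.log 2)
  refine max_le_max le_rfl (max_le_max (by linarith) ?_)
  exact mul_le_mul_of_nonneg_left (by linarith) this.le

/-- Both cases are tight: `4 / 9 - 2 * (1 / 9) = 2 / 9` for two randomized responses. With the other
mechanism only its revealing outcome, of mass `2 / 9`, contributes, since `2 / 3 - 2 * (1 / 3) = 0`.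
-/
theorem exists_isComposition_answerCurve_pair (rr : Bool) :
    ∃ g, IsComposition [answerCurve true, answerCurve rr] g ∧ privacyBound ≤ g := by
  cases rr
  · refine exists_isComposition_pair log_two_nonneg le_rfl zero_le_one le_rfl (by norm_num)
      (by norm_num) ?_ ?_ <;>
      simp only [Fin.sum_univ_four, canonP, canonQ, exp_log_two, Real.exp_zero, Matrix.cons_val] <;>
      norm_num
  · refine exists_isComposition_pair log_two_nonneg le_rfl zero_le_one log_two_nonneg le_rfl
      zero_le_one ?_ ?_ <;>
      simp only [Fin.sum_univ_four, canonP, canonQ, exp_log_two, Matrix.cons_val] <;>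
      norm_num

variable {𝒟 : Type*}

open Classical in
/-- The analyst who first asks for a randomized response and then, depending on the answer, for
another one or for a mechanism that reveals the dataset with a small probability. -/
noncomputable def separatingAdversary (D₁ : 𝒟) : Adversary 𝒟 where
  Y _ := Bool
  measurableSpaceY _ := inferInstance
  mech i D := Kernel.ofFunOfCountable fun h =>
    bernoulli (answerProb (decide (D = D₁)) (asksResponse i h))
  isMarkov _ _ := ⟨fun _ =>
    isProbabilityMeasure_bernoulli (answerProb_nonneg _ _) (answerProb_le_one _ _)⟩
  curve i h := if i < 2 then some (answerCurve (asksResponse i h)) else none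

variable {D₁ D₂ : 𝒟}

theorem separatingAdversary_respects (hD : D₁ ≠ D₂) :
    (separatingAdversary D₁).Respects D₁ D₂ epsDeltaCurves := by
  classical
  intro i h f hf
  obtain ⟨-, rfl⟩ : i < 2 ∧ answerCurve (asksResponse i h) = f := by
    simpa [separatingAdversary] using hf
  refine ⟨answerCurve_mem _, ?_⟩
  change _ ≤ tradeoff (bernoulli (answerProb (decide (D₁ = D₁)) (asksResponse i h)))
    (bernoulli (answerProb (decide (D₂ = D₁)) (asksResponse i h)))
  rw [decide_eq_true rfl, decide_eq_false hD.symm]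
  exact answerCurve_le_tradeoff _

/-- Transcripts form a countable space with measurable points, so the filter's rule need not be
inspected. -/
theorem separatingAdversary_measurableDecisions :
    (separatingAdversary D₁).MeasurableDecisions privacyBound := by
  intro i
  have h1 : ∀ i, MeasurableSingletonClass ((separatingAdversary D₁).Y i) := fun _ =>
    inferInstanceAs (MeasurableSingletonClass Bool)
  have h2 : ∀ i, Countable ((separatingAdversary D₁).Y i) := fun _ =>
    inferInstanceAs (Countable Bool)
  exact (Set.to_countable _).measurableSet

theorem separatingAdversary_accepted_zero :
    (separatingAdversary D₁).Accepted privacyBound 0 () :=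
  ⟨[answerCurve true], rfl, exists_isComposition_answerCurve⟩

theorem separatingAdversary_accepted_one (y : Bool) :
    (separatingAdversary D₁).Accepted privacyBound 1 ((), Sum.inl y) :=
  ⟨[answerCurve true, answerCurve y], rfl, exists_isComposition_answerCurve_pair y⟩

open Classical in
theorem separatingAdversary_law_two
    (hA : (separatingAdversary D₁).MeasurableDecisions privacyBound) (D : 𝒟) :
    ((separatingAdversary D₁).law hA D 2).real
        {h : Transcript (fun _ => Bool) 2 | h.2 ∈ Sum.inl '' {true}} =
      answerProb (decide (D = D₁)) true * answerProb (decide (D = D₁)) true +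
        (1 - answerProb (decide (D = D₁)) true) * answerProb (decide (D = D₁)) false := by
  generalize hd : decide (D = D₁) = d
  have key : (separatingAdversary D₁).law hA D 2
      {h : Transcript (fun _ => Bool) 2 | h.2 ∈ Sum.inl '' {true}} =
      ∫⁻ y, bernoulli (answerProb (decide (D = D₁)) y) {true}
        ∂(bernoulli (answerProb (decide (D = D₁)) true)) :=
    (separatingAdversary D₁).law_two_inl hA D separatingAdversary_accepted_zero
      separatingAdversary_accepted_one (measurableSet_singleton true)
  have h0 := answerProb_nonneg d
  have h1 : 0 ≤ 1 - answerProb d true := sub_nonneg.2 (answerProb_le_one d true)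
  rw [Measure.real, key, hd, bernoulli, lintegral_weighted]
  simp only [bernoulli_true, Fintype.sum_bool, cond_true, cond_false]
  rw [← ENNReal.ofReal_mul (h0 _), ← ENNReal.ofReal_mul h1, ← ENNReal.ofReal_add
    (mul_nonneg (h0 _) (h0 _)) (mul_nonneg h1 (h0 _)), ENNReal.toReal_ofReal
    (add_nonneg (mul_nonneg (h0 _) (h0 _)) (mul_nonneg h1 (h0 _)))]

/-- One analyst and one bound serve every family containing `epsDeltaCurves`, hence both halves of
`mainTheorem9`. -/
theorem not_filterIsFree (hD : D₁ ≠ D₂) {F : Set Curve} (hF : epsDeltaCurves ⊆ F) {k : ℕ}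
    (hk : 2 ≤ k) : ¬ FilterIsFree D₁ D₂ F privacyBound k := by
  classical
  intro hfree
  have hA := separatingAdversary_measurableDecisions (D₁ := D₁)
  -- Forgetting the rounds after the second can only raise the curve, so a violation at two rounds
  -- suffices.
  have hle := (hfree (separatingAdversary D₁) (fun i h f hf =>
    (separatingAdversary_respects hD i h f hf).imp_left fun h => hF h) hA).trans
    ((separatingAdversary D₁).antitone_tradeoff_law hA D₁ D₂ hk)
  -- `1 / 9 = 1/3 * 1/3 + 2/3 * 0` and `14 / 27 = 2/3 * 2/3 + 1/3 * 2/9`.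
  obtain ⟨S, hS, l1, l2⟩ : ∃ S : Set (Transcript (separatingAdversary D₁).Y 2), MeasurableSet S ∧
      ((separatingAdversary D₁).law hA D₁ 2).real S = 1 / 9 ∧
      ((separatingAdversary D₁).law hA D₂ 2).real S = 14 / 27 := by
    refine ⟨_, measurable_snd (MeasurableSet.inl_image (measurableSet_singleton true)),
      (separatingAdversary_law_two hA D₁).trans ?_, (separatingAdversary_law_two hA D₂).trans ?_⟩
    · rw [decide_eq_true rfl]
      norm_num [answerProb]
    · rw [decide_eq_false hD.symm]
      norm_num [answerProb]
  -- At `α = 1 / 9` this test has type II error `13 / 27`, below the value `5 / 9` required by the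
  -- bound.
  have ht := tradeoff_le_one_sub (Q := (separatingAdversary D₁).law hA D₂ 2)
    (α := ⟨1 / 9, by norm_num, by norm_num⟩) hS l1.le
  rw [l2] at ht
  have hb : 1 - 2 / 9 - Real.exp (Real.log 2) * (1 / 9) ≤
      privacyBound ⟨1 / 9, by norm_num, by norm_num⟩ :=
    (le_max_left _ _).trans (le_max_right _ _)
  have := hb.trans ((hle _).trans ht)
  norm_num [exp_log_two] at this

end Counterexample

end FDP

theorem mainTheorem9 {𝒟 : Type*} (D₁ D₂ : 𝒟) (hD : D₁ ≠ D₂) (k : ℕ) (hk : 2 ≤ k) :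
    ¬ FDP.AdmitsFreeFilters D₁ D₂ FDP.allTradeoffCurves k ∧
      ¬ FDP.AdmitsFreeFilters D₁ D₂ FDP.epsDeltaCurves k :=
  ⟨fun h => FDP.not_filterIsFree hD FDP.epsDeltaCurves_subset_allTradeoffCurves hk
      (h _ FDP.privacyBound_mem),
    fun h => FDP.not_filterIsFree hD subset_rfl hk (h _ FDP.privacyBound_mem)⟩
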